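/- Let $G$ be a compactly generated locally compact Hausdorff group. Let $\mathrm{Sub}(G)$ be the space of closed subgroups of $G$ with the Chabauty topology, which is generated by the sets $\{H : H\cap U\neq\emptyset\}$ for $U\subset G$ open and $\{H : H\cap K=\emptyset\}$ for $K\subset G$ compact. Let $\mathrm{ULat}(G)\subset \mathrm{Sub}(G)$, with the induced topology, be the subspace of uniform lattices, i.e. of the discrete subgroups $\Gamma$ such that $G=\Gamma K$ for some compact $K\subset G$. Let $\mathrm{IRS}(G)$ be the space of invariant random subgroups of $G$, i.e. of the regular Borel probability measures on $\mathrm{Sub}(G)$ that are invariant under conjugation by every element of $G$, with the weak-$*$ topology. Then for every $\Gamma\in\mathrm{ULat}(G)$ there is a unique $G$-invariant regular Borel probability measure $\nu_\Gamma$ on $G/\Gamma$, its pushforward $\mu_\Gamma$ to $\mathrm{Sub}(G)$ under the map $g\Gamma\mapsto g\Gamma g^{-1}$ belongs to $\mathrm{IRS}(G)$, and the map $$\mathrm{I}:\mathrm{ULat}(G)\to\mathrm{IRS}(G),\qquad \mathrm{I}(\Gamma)=\mu_\Gamma,$$ is continuous. -/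

import Mathlib

open MeasureTheory Topology
open scoped Pointwise

theorem mem_map_conj_iff {G : Type*} [Group G] (g : G) (H : Subgroup G) (x : G) :
    x ∈ H.map (MulAut.conj g).toMonoidHom ↔ g⁻¹ * x * g ∈ H := by
  constructor
  · rintro ⟨y, hy, rfl⟩
    have h : g⁻¹ * (g * y * g⁻¹) * g = y := by group
    change g⁻¹ * (g * y * g⁻¹) * g ∈ H
    rw [h]
    exact hy
  · intro hx
    refine ⟨g⁻¹ * x * g, hx, ?_⟩
    change g * (g⁻¹ * x * g) * g⁻¹ = x
    group

section ChabautySpace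

variable {G : Type*} [Group G] [TopologicalSpace G]

/-- A topological group is compactly generated if some compact subset generates it as an
abstract group. -/
def IsCompactlyGeneratedGroup (G : Type*) [Group G] [TopologicalSpace G] : Prop :=
  ∃ S : Set G, IsCompact S ∧ Subgroup.closure S = ⊤

/-- The Chabauty topology on the set of closed subgroups: it is generated by the sets of closed
subgroups meeting a given open set and those of closed subgroups avoiding a given compact set. -/
instance chabautyTopology : TopologicalSpace (ClosedSubgroup G) :=
  TopologicalSpace.generateFrom
    ({O | ∃ U : Set G, IsOpen U ∧ O = {H : ClosedSubgroup G | ((H : Set G) ∩ U).Nonempty}} ∪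
     {O | ∃ K : Set G, IsCompact K ∧ O = {H : ClosedSubgroup G | (H : Set G) ∩ K = ∅}})

/-- The Borel sigma-algebra of the Chabauty space. -/
instance chabautyMeasurableSpace : MeasurableSpace (ClosedSubgroup G) :=
  borel (ClosedSubgroup G)

instance chabautyBorelSpace : BorelSpace (ClosedSubgroup G) := ⟨rfl⟩

/-- The closed subgroup `g H g⁻¹`. -/
def conjClosed [IsTopologicalGroup G] (g : G) (H : ClosedSubgroup G) : ClosedSubgroup G where
  toSubgroup := H.toSubgroup.map (MulAut.conj g).toMonoidHom
  isClosed' := by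
    have h : ((H.toSubgroup.map (MulAut.conj g).toMonoidHom : Subgroup G) : Set G) =
        (fun x : G => g⁻¹ * x * g) ⁻¹' (H.toSubgroup : Set G) :=
      Set.ext fun x => mem_map_conj_iff g H.toSubgroup x
    change IsClosed ((H.toSubgroup.map (MulAut.conj g).toMonoidHom : Subgroup G) : Set G)
    rw [h]
    exact H.isClosed'.preimage (by fun_prop)

/-- A uniform lattice: a discrete subgroup `Γ` with `G = Γ K` for some compact `K`. -/
def IsUniformLattice (Γ : Subgroup G) : Prop :=
  DiscreteTopology Γ ∧ ∃ K : Set G, IsCompact K ∧ (Γ : Set G) * K = Set.univ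

/-- The space of uniform lattices, with the topology induced from the Chabauty space. In a
Hausdorff group every discrete subgroup is closed, so no uniform lattice is left out. -/
abbrev ULat (G : Type*) [Group G] [TopologicalSpace G] : Type _ :=
  {Γ : ClosedSubgroup G // IsUniformLattice Γ.toSubgroup}

/-- The coset space `G ⧸ Γ`. -/
abbrev ULat.Cosets (Γ : ULat G) : Type _ := G ⧸ Γ.1.toSubgroup

/-- Borel measures on the coset space `G ⧸ Γ`. -/
abbrev ULat.CosetMeasure (Γ : ULat G) : Type _ := @Measure Γ.Cosets (borel Γ.Cosets)

/-- `ν` is a `G`-invariant regular Borel probability measure on `G ⧸ Γ`. -/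
structure ULat.IsInvariantProbability (Γ : ULat G) (ν : Γ.CosetMeasure) : Prop where
  isProbability : @IsProbabilityMeasure Γ.Cosets (borel Γ.Cosets) ν
  regular : @Measure.Regular Γ.Cosets (borel Γ.Cosets) _ ν
  invariant : ∀ g : G,
    @Measure.map Γ.Cosets Γ.Cosets (borel Γ.Cosets) (borel Γ.Cosets) (fun x => g • x) ν = ν

/-- The map `G ⧸ Γ → Sub G`, `g Γ ↦ g Γ g⁻¹`. -/
def ULat.cosetConj [IsTopologicalGroup G] (Γ : ULat G) : Γ.Cosets → ClosedSubgroup G :=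
  Quotient.lift (fun g : G => conjClosed g Γ.1) (by
    intro a b hab
    have hab' : a⁻¹ * b ∈ Γ.1.toSubgroup := QuotientGroup.leftRel_apply.mp hab
    apply ClosedSubgroup.toSubgroup_injective
    ext x
    change x ∈ Γ.1.toSubgroup.map (MulAut.conj a).toMonoidHom ↔
      x ∈ Γ.1.toSubgroup.map (MulAut.conj b).toMonoidHom
    rw [mem_map_conj_iff, mem_map_conj_iff]
    have h : b⁻¹ * x * b = (a⁻¹ * b)⁻¹ * (a⁻¹ * x * a) * (a⁻¹ * b) := by group
    rw [h, Subgroup.mul_mem_cancel_right _ hab',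
      Subgroup.mul_mem_cancel_left _ (Subgroup.inv_mem _ hab')])

/-- The pushforward to the Chabauty space of a Borel measure on `G ⧸ Γ` along
`g Γ ↦ g Γ g⁻¹`. -/
noncomputable def ULat.pushforward [IsTopologicalGroup G] (Γ : ULat G) (ν : Γ.CosetMeasure) :
    Measure (ClosedSubgroup G) :=
  @Measure.map Γ.Cosets (ClosedSubgroup G) (borel Γ.Cosets) _ Γ.cosetConj ν

/-- The space of invariant random subgroups: regular Borel probability measures on the Chabauty
space that are invariant under conjugation by every element of `G`. The topology is the one
induced from `ProbabilityMeasure`, that is, the weak-star topology (convergence of the integrals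
of all continuous functions on the compact space of closed subgroups). -/
abbrev IRS (G : Type*) [Group G] [TopologicalSpace G] [IsTopologicalGroup G] : Type _ :=
  {μ : ProbabilityMeasure (ClosedSubgroup G) //
    (μ : Measure (ClosedSubgroup G)).Regular ∧
    ∀ g : G, (μ : Measure (ClosedSubgroup G)).map (conjClosed g) = μ}

end ChabautySpace

/-! ### Joint continuity in the Chabauty space, and uniform cocompactness near a lattice. -/

section ChabautyContinuity

open Filter Set

variable {G : Type*} [Group G] [TopologicalSpace G]

/-! Compact generation makes cocompactness locally uniform: one compact set works for all closed
subgroups near a given uniform lattice (`eventually_mul_eq_univ`). Hence each lattice `Γ'` near `Γ`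
has a density `φ` supported in one fixed compact set, of Haar integral 1, with constant sums over
cosets of `Γ'`; then `ν_Γ'` is integration against `φ μ`
(`ULat.IsInvariantProbability.integral_eq`). The group being unimodular, the unfolding formula makes
this functional invariant, and uniqueness of Haar measure makes it the only normalized invariant
positive one (`IsCosetWeight.eq_integral_of_invariant`).

For continuity, no convergence of the densities is needed. Take any ultrafilter converging to `Γ`.
The integrals of a fixed function on `G ⧸ Γ` against the densities of `Γ'` have a limit, which is a
positive normalized functional. It is invariant on functions that extend continuously to all nearby
coset spaces, and by Stone–Weierstrass these are dense. Uniqueness identifies the limit with `ν_Γ`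
(`tendsto_ultrafilter_integral_of_isCosetWeight`). -/

theorem isOpen_setOf_inter_nonempty {U : Set G} (hU : IsOpen U) :
    IsOpen {H : ClosedSubgroup G | ((H : Set G) ∩ U).Nonempty} :=
  TopologicalSpace.isOpen_generateFrom_of_mem (Or.inl ⟨U, hU, rfl⟩)

theorem isOpen_setOf_inter_eq_empty {K : Set G} (hK : IsCompact K) :
    IsOpen {H : ClosedSubgroup G | (H : Set G) ∩ K = ∅} :=
  TopologicalSpace.isOpen_generateFrom_of_mem (Or.inr ⟨K, hK, rfl⟩)

theorem ClosedSubgroup.isClosed_coe (H : ClosedSubgroup G) : IsClosed (H : Set G) := H.isClosed'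

instance chabauty_t2Space [T2Space G] [LocallyCompactSpace G] : T2Space (ClosedSubgroup G) := by
  have key : ∀ H₁ H₂ : ClosedSubgroup G, ∀ x ∈ H₁, x ∉ H₂ →
      ∃ u v : Set (ClosedSubgroup G), IsOpen u ∧ IsOpen v ∧ H₁ ∈ u ∧ H₂ ∈ v ∧ Disjoint u v := by
    intro H₁ H₂ x h₁ h₂
    obtain ⟨K, hK, hxK, hKs⟩ := exists_compact_subset H₂.isClosed_coe.isOpen_compl h₂
    refine ⟨_, _, isOpen_setOf_inter_nonempty isOpen_interior, isOpen_setOf_inter_eq_empty hK,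
      ⟨x, h₁, hxK⟩, ?_, ?_⟩
    · exact Set.eq_empty_of_forall_notMem fun y hy => hKs hy.2 hy.1
    · refine Set.disjoint_left.mpr ?_
      rintro H ⟨y, hyH, hyK⟩ hH
      have : y ∈ (H : Set G) ∩ K := ⟨hyH, interior_subset hyK⟩
      rw [mem_ofPred_eq] at hH
      rw [hH] at this
      exact this
  refine ⟨fun H₁ H₂ hne => ?_⟩
  by_cases h : ∀ x ∈ H₁, x ∈ H₂
  · have h' : ∃ x ∈ H₂, x ∉ H₁ := by
      by_contra! hc
      exact hne (SetLike.ext fun x => ⟨h x, hc x⟩)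
    obtain ⟨x, hx₂, hx₁⟩ := h'
    obtain ⟨u, v, hu, hv, h2, h1, hd⟩ := key H₂ H₁ x hx₂ hx₁
    exact ⟨v, u, hv, hu, h1, h2, hd.symm⟩
  · push Not at h
    obtain ⟨x, hx₁, hx₂⟩ := h
    exact key H₁ H₂ x hx₁ hx₂

theorem eventually_exists_mem_of_isOpen {X : Type*} [TopologicalSpace X] {a : X × G → G}
    (ha : Continuous a) {U : Set G} (hU : IsOpen U) {x : X} {H : ClosedSubgroup G} {h : G}
    (hh : h ∈ H) (hxh : a (x, h) ∈ U) :
    ∀ᶠ p : X × ClosedSubgroup G in 𝓝 (x, H), ∃ h ∈ p.2, a (p.1, h) ∈ U := by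
  have h1 : a ⁻¹' U ∈ 𝓝 (x, h) := (hU.preimage ha).mem_nhds hxh
  obtain ⟨V, hV, W, hW, hVW⟩ := mem_nhds_prod_iff.mp h1
  have h2 : {H : ClosedSubgroup G | ((H : Set G) ∩ interior W).Nonempty} ∈ 𝓝 H :=
    (isOpen_setOf_inter_nonempty isOpen_interior).mem_nhds ⟨h, hh, mem_interior_iff_mem_nhds.mpr hW⟩
  filter_upwards [prod_mem_nhds hV h2]
  rintro ⟨y, H'⟩ ⟨hy, k, hk, hkW⟩
  exact ⟨k, hk, hVW ⟨hy, interior_subset hkW⟩⟩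

/-- Since `b (g, ·)` inverts `a (g, ·)`, a point `h` with `a (g', h) ∈ K` and `g'` in a compact
neighbourhood `V` lies in the compact set `b '' (V ×ˢ K)`; avoiding that set is a Chabauty-open
condition. Here `a` will be translation or conjugation. -/
theorem eventually_forall_notMem_of_isCompact [LocallyCompactSpace G] {a b : G × G → G}
    (hb : Continuous b) (hba : ∀ g x, b (g, a (g, x)) = x) (hab : ∀ g x, a (g, b (g, x)) = x)
    {K : Set G} (hK : IsCompact K) {g : G} {H : ClosedSubgroup G}
    (hH : ∀ h ∈ H, a (g, h) ∉ K) :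
    ∀ᶠ p : G × ClosedSubgroup G in 𝓝 (g, H), ∀ h ∈ p.2, a (p.1, h) ∉ K := by
  have h1 : ∀ᶠ g' in 𝓝 g, ∀ x ∈ K, b (g', x) ∉ H := by
    refine hK.eventually_forall_of_forall_eventually fun x hx => ?_
    refine (H.isClosed_coe.isOpen_compl.preimage hb).mem_nhds ?_
    intro hbx
    exact hH _ hbx (by rw [hab]; exact hx)
  obtain ⟨V, hV, hVs, hVc⟩ := local_compact_nhds h1
  have h2 : {H : ClosedSubgroup G | (H : Set G) ∩ b '' (V ×ˢ K) = ∅} ∈ 𝓝 H := by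
    refine (isOpen_setOf_inter_eq_empty ((hVc.prod hK).image hb)).mem_nhds ?_
    refine Set.eq_empty_of_forall_notMem ?_
    rintro _ ⟨hy, ⟨g', x⟩, ⟨hg', hx⟩, rfl⟩
    exact hVs hg' x hx hy
  filter_upwards [prod_mem_nhds hV h2]
  rintro ⟨g', H'⟩ ⟨hg', hH'⟩ h hh hhK
  have : h ∈ (H' : Set G) ∩ b '' (V ×ˢ K) := ⟨hh, (g', a (g', h)), ⟨hg', hhK⟩, hba _ _⟩
  rw [mem_ofPred_eq] at hH'
  rw [hH'] at this
  exact this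

/-- The supremum of a function over the left coset `g H`. -/
noncomputable def cosetSup (f : G → ℝ) (g : G) (H : ClosedSubgroup G) : ℝ :=
  ⨆ h : H, f (g * h)

theorem cosetSup_mul_right (f : G → ℝ) (g : G) (H : ClosedSubgroup G) {h : G} (hh : h ∈ H) :
    cosetSup f (g * h) H = cosetSup f g H := by
  unfold cosetSup
  refine (Equiv.mulLeft (⟨h, hh⟩ : H)).iSup_congr fun x => ?_
  simp [mul_assoc]

variable [IsTopologicalGroup G]

theorem mem_conjClosed_iff {g x : G} {H : ClosedSubgroup G} :
    x ∈ conjClosed g H ↔ g⁻¹ * x * g ∈ H :=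
  mem_map_conj_iff g H.toSubgroup x

theorem continuous_conjClosed [LocallyCompactSpace G] :
    Continuous fun p : G × ClosedSubgroup G => conjClosed p.1 p.2 := by
  refine continuous_generateFrom_iff.mpr ?_
  rintro _ (⟨U, hU, rfl⟩ | ⟨K, hK, rfl⟩) <;> refine isOpen_iff_mem_nhds.mpr ?_
  · rintro ⟨g, H⟩ ⟨x, hx, hxU⟩
    have := eventually_exists_mem_of_isOpen (a := fun p : G × G => p.1 * p.2 * p.1⁻¹)
      (by fun_prop) hU (mem_conjClosed_iff.mp hx) (x := g) (by convert hxU; group)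
    filter_upwards [this]
    rintro ⟨g', H'⟩ ⟨h, hh, hhU⟩
    exact ⟨_, mem_conjClosed_iff.mpr (by convert hh; group), hhU⟩
  · rintro ⟨g, H⟩ hgH
    have := eventually_forall_notMem_of_isCompact (a := fun p : G × G => p.1 * p.2 * p.1⁻¹)
      (b := fun p : G × G => p.1⁻¹ * p.2 * p.1) (by fun_prop) (by intros; group)
      (by intros; group) hK (g := g) (H := H) ?_
    · filter_upwards [this]
      rintro ⟨g', H'⟩ h
      refine Set.eq_empty_of_forall_notMem ?_
      rintro x ⟨hx, hxK⟩
      refine h _ (mem_conjClosed_iff.mp hx) ?_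
      convert hxK
      group
    · intro h hh hhK
      exact (Set.eq_empty_iff_forall_notMem.mp hgH) _
        ⟨mem_conjClosed_iff.mpr (by convert hh; group), hhK⟩

theorem HasCompactSupport.bddAbove_range_of_continuous {X Y : Type*} [TopologicalSpace X]
    {f : X → ℝ} (hf : Continuous f) (hfc : HasCompactSupport f) (u : Y → X) :
    BddAbove (range fun y => f (u y)) :=
  (hf.bddAbove_range_of_hasCompactSupport hfc).mono (range_comp_subset_range u f)

/-- A supremum, unlike a sum, makes sense over every closed subgroup, discrete or not. The two kinds
of subbasic Chabauty sets give its lower and upper semicontinuity. -/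
theorem continuous_cosetSup [LocallyCompactSpace G] {f : G → ℝ} (hf : Continuous f)
    (hfc : HasCompactSupport f) (hf0 : ∀ x, 0 ≤ f x) :
    Continuous fun p : G × ClosedSubgroup G => cosetSup f p.1 p.2 := by
  have hbdd : ∀ (g : G) (H : ClosedSubgroup G), BddAbove (range fun h : H => f (g * h)) :=
    fun g H => HasCompactSupport.bddAbove_range_of_continuous hf hfc fun h : H => g * (h : G)
  refine continuous_iff_continuousAt.mpr ?_
  rintro ⟨g, H⟩
  refine tendsto_order.mpr ⟨fun c hc => ?_, fun c hc => ?_⟩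
  · obtain ⟨⟨h, hh⟩, hlt⟩ := exists_lt_of_lt_ciSup hc
    filter_upwards [eventually_exists_mem_of_isOpen (a := fun p : G × G => p.1 * p.2)
      (by fun_prop) (isOpen_Ioi.preimage hf) hh hlt]
    rintro ⟨g', H'⟩ ⟨k, hk, hkc⟩
    exact lt_of_lt_of_le hkc (le_ciSup (hbdd g' H') ⟨k, hk⟩)
  · obtain ⟨b, hb, hbc⟩ := exists_between hc
    have hle : ∀ h ∈ H, f (g * h) < b := fun h hh =>
      (le_ciSup (hbdd g H) ⟨h, hh⟩).trans_lt hb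
    -- Positivity of `b` puts the superlevel set `{b ≤ f}` inside the support, hence makes it
    -- compact.
    have hb0 : 0 < b := (hf0 _).trans_lt (hle 1 (one_mem H))
    have hC : IsCompact {x | b ≤ f x} := by
      refine hfc.isCompact.of_isClosed_subset (isClosed_le continuous_const hf) fun x hx => ?_
      exact subset_tsupport f (hb0.trans_le hx).ne'
    filter_upwards [eventually_forall_notMem_of_isCompact (a := fun p : G × G => p.1 * p.2)
      (b := fun p : G × G => p.1⁻¹ * p.2) (by fun_prop) (by intros; group)
      (by intros; group) hC (g := g) (H := H) fun h hh => not_le.mpr (hle h hh)]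
    rintro ⟨g', H'⟩ h
    exact (ciSup_le fun x : H' => (not_le.mp (h x x.2)).le).trans_lt hbc

/-- With `K' = V⁻¹VK`, finitely many sets `γ · int V · K` cover `K'(S ∪ S⁻¹)`. A nearby `H` contains
some `γw` with `w ∈ int V` for each of these `γ`, and `γvk = (γw)(w⁻¹vk) ∈ HK'`. So `HK'` is stable
under right multiplication by the generators and their inverses, and is all of `G`. -/
theorem eventually_mul_eq_univ [LocallyCompactSpace G] (hG : IsCompactlyGeneratedGroup G)
    {Γ : ClosedSubgroup G} {K : Set G} (hK : IsCompact K) (hΓ : (Γ : Set G) * K = univ) :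
    ∃ K' : Set G, IsCompact K' ∧ ∀ᶠ H : ClosedSubgroup G in 𝓝 Γ, (H : Set G) * K' = univ := by
  obtain ⟨S, hS, hSG⟩ := hG
  obtain ⟨V, hV, hV1⟩ := exists_compact_mem_nhds (1 : G)
  refine ⟨V⁻¹ * (V * K), hV.inv.mul (hV.mul hK), ?_⟩
  have hcover : (V⁻¹ * (V * K)) * (S ∪ S⁻¹) ⊆ ⋃ γ : Γ, ({(γ : G)} : Set G) * (interior V * K) := by
    intro x _
    obtain ⟨γ, hγ, k, hk, rfl⟩ : x ∈ (Γ : Set G) * K := hΓ ▸ mem_univ x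
    refine mem_iUnion.mpr ⟨⟨γ, hγ⟩, mul_mem_mul rfl ?_⟩
    exact ⟨1, mem_interior_iff_mem_nhds.mpr hV1, k, hk, one_mul k⟩
  obtain ⟨F, hF⟩ := ((hV.inv.mul (hV.mul hK)).mul (hS.union hS.inv)).elim_finite_subcover _
    (fun γ : Γ => isOpen_interior.mul_right.mul_left) hcover
  have hev : ∀ᶠ H : ClosedSubgroup G in 𝓝 Γ, ∀ γ ∈ F,
      ((H : Set G) ∩ ({(γ : G)} * interior V)).Nonempty := by
    refine (Filter.eventually_all_finset F).mpr fun γ _ => ?_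
    refine (isOpen_setOf_inter_nonempty isOpen_interior.mul_left).mem_nhds ?_
    exact ⟨γ, γ.2, γ, rfl, 1, mem_interior_iff_mem_nhds.mpr hV1, mul_one _⟩
  filter_upwards [hev] with H hH
  have hstep : ∀ p ∈ (H : Set G) * (V⁻¹ * (V * K)), ∀ s ∈ S ∪ S⁻¹,
      p * s ∈ (H : Set G) * (V⁻¹ * (V * K)) := by
    rintro _ ⟨h, hh, k, hk, rfl⟩ s hs
    obtain ⟨γ, hγF, _, rfl, y, ⟨v, hv, k', hk', rfl⟩, hy⟩ := by
      simpa only [mem_iUnion, exists_prop] using hF (mul_mem_mul hk hs)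
    obtain ⟨_, hγH, _, rfl, w, hw, rfl⟩ := hH γ hγF
    refine ⟨h * (γ * w), mul_mem hh hγH, w⁻¹ * (v * k'),
      mul_mem_mul (Set.inv_mem_inv.mpr (interior_subset hw))
        (mul_mem_mul (interior_subset hv) hk'), ?_⟩
    simp only at hy ⊢
    rw [mul_assoc h k s, ← hy]
    group
  -- Stability under `g` and `g⁻¹` is carried together so that the inverse case of the induction is
  -- a swap.
  have hall : ∀ g ∈ Subgroup.closure S, ∀ p ∈ (H : Set G) * (V⁻¹ * (V * K)),
      p * g ∈ (H : Set G) * (V⁻¹ * (V * K)) ∧ p * g⁻¹ ∈ (H : Set G) * (V⁻¹ * (V * K)) := by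
    intro g hg
    induction hg using Subgroup.closure_induction with
    | mem x hx =>
      exact fun p hp => ⟨hstep p hp x (Or.inl hx),
        hstep p hp x⁻¹ (Or.inr (Set.inv_mem_inv.mpr hx))⟩
    | one => simp
    | mul x y _ _ ihx ihy =>
      intro p hp
      refine ⟨?_, ?_⟩
      · rw [← mul_assoc p]
        exact (ihy _ (ihx p hp).1).1
      · rw [mul_inv_rev, ← mul_assoc p]
        exact (ihx _ (ihy p hp).2).2
    | inv x _ ih =>
      intro p hp
      rw [inv_inv]
      exact (ih p hp).symm
  obtain ⟨_, _, k, hk, _⟩ : (1 : G) ∈ (Γ : Set G) * K := hΓ ▸ mem_univ _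
  have hp : k ∈ (H : Set G) * (V⁻¹ * (V * K)) :=
    ⟨1, one_mem H, k, ⟨1, Set.mem_inv.mpr (by simpa using mem_of_mem_nhds hV1), k,
      ⟨1, mem_of_mem_nhds hV1, k, hk, one_mul k⟩, one_mul k⟩, one_mul k⟩
  refine eq_univ_of_forall fun g => ?_
  have := (hall (k⁻¹ * g) (hSG ▸ Subgroup.mem_top _) k hp).1
  rwa [mul_inv_cancel_left] at this

end ChabautyContinuity

/-! ### Periodization over a discrete subgroup, unfolding, and coset weights. -/

section Periodize

open Filter Set

variable {G : Type*} [Group G]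

/-- The sum of a function over the left coset `g Γ`. -/
noncomputable def periodize (Γ : Subgroup G) (f : G → ℝ) (g : G) : ℝ := ∑ᶠ γ : Γ, f (g * γ)

theorem periodize_mul_right (Γ : Subgroup G) (f : G → ℝ) (g : G) {γ : G} (hγ : γ ∈ Γ) :
    periodize Γ f (g * γ) = periodize Γ f g := by
  unfold periodize
  rw [← finsum_comp_equiv (Equiv.mulLeft (⟨γ, hγ⟩ : Γ)) (f := fun x : Γ => f (g * x))]
  simp [mul_assoc]

theorem periodize_comp_mul_left (Γ : Subgroup G) (f : G → ℝ) (h g : G) :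
    periodize Γ (fun x => f (h * x)) g = periodize Γ f (h * g) := by
  simp [periodize, mul_assoc]

theorem periodize_mul_invariant (Γ : Subgroup G) (f u : G → ℝ)
    (hu : ∀ g, ∀ γ ∈ Γ, u (g * γ) = u g) (g : G) :
    periodize Γ (fun x => f x * u x) g = periodize Γ f g * u g := by
  unfold periodize
  rw [finsum_mul]
  exact finsum_congr fun γ => congrArg (f (g * γ) * ·) (hu g γ γ.2)

theorem periodize_nonneg (Γ : Subgroup G) {f : G → ℝ} (hf : ∀ x, 0 ≤ f x) (g : G) :
    0 ≤ periodize Γ f g :=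
  finsum_nonneg fun _ => hf _

variable [TopologicalSpace G]

theorem Subgroup.finite_setOf_mem_of_isCompact (Γ : Subgroup G) [DiscreteTopology Γ]
    [hΓ : IsClosed (Γ : Set G)] {C : Set G} (hC : IsCompact C) : {γ : Γ | (γ : G) ∈ C}.Finite :=
  (hΓ.isClosedEmbedding_subtypeVal.isCompact_preimage hC).finite_of_discrete

variable [IsTopologicalGroup G] (Γ : Subgroup G) [DiscreteTopology Γ] [IsClosed (Γ : Set G)]

theorem locallyFinite_support_mul_right [LocallyCompactSpace G] {f : G → ℝ}
    (hfc : HasCompactSupport f) :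
    LocallyFinite fun γ : Γ => Function.support fun g => f (g * γ) := by
  intro g
  obtain ⟨V, hV, hVg⟩ := exists_compact_mem_nhds g
  refine ⟨V, hVg, (Γ.finite_setOf_mem_of_isCompact (hV.inv.mul hfc.isCompact)).subset ?_⟩
  rintro γ ⟨x, hx, hxV⟩
  exact ⟨x⁻¹, Set.inv_mem_inv.mpr hxV, x * γ, subset_tsupport f hx, inv_mul_cancel_left _ _⟩

theorem hasFiniteSupport_mul_right {f : G → ℝ}
    (hfc : HasCompactSupport f) (g : G) : (fun γ : Γ => f (g * γ)).HasFiniteSupport := by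
  refine (Γ.finite_setOf_mem_of_isCompact (isCompact_singleton (x := g⁻¹).mul
    hfc.isCompact)).subset ?_
  intro γ hγ
  exact ⟨g⁻¹, rfl, g * γ, subset_tsupport f hγ, inv_mul_cancel_left _ _⟩

theorem continuous_periodize [LocallyCompactSpace G] {f : G → ℝ} (hf : Continuous f)
    (hfc : HasCompactSupport f) : Continuous (periodize Γ f) :=
  continuous_finsum (fun _ => by fun_prop) (locallyFinite_support_mul_right Γ hfc)

theorem periodize_add {f₁ f₂ : G → ℝ} (h₁ : HasCompactSupport f₁) (h₂ : HasCompactSupport f₂)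
    (g : G) : periodize Γ (fun x => f₁ x + f₂ x) g = periodize Γ f₁ g + periodize Γ f₂ g :=
  finsum_add_distrib (hasFiniteSupport_mul_right Γ h₁ g) (hasFiniteSupport_mul_right Γ h₂ g)

omit [TopologicalSpace G] [IsTopologicalGroup G] [DiscreteTopology Γ] [IsClosed (Γ : Set G)] in
theorem periodize_const_mul (c : ℝ) (f : G → ℝ) (g : G) :
    periodize Γ (fun x => c * f x) g = c * periodize Γ f g :=
  (mul_finsum _ _).symm

theorem periodize_pos {f : G → ℝ} (hfc : HasCompactSupport f) (hf : ∀ x, 0 ≤ f x) {g γ : G}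
    (hγ : γ ∈ Γ) (hg : 0 < f (g * γ)) : 0 < periodize Γ f g :=
  hg.trans_le (single_le_finsum (⟨γ, hγ⟩ : Γ) (hasFiniteSupport_mul_right Γ hfc g)
    fun _ => hf _)

variable [MeasurableSpace G] [BorelSpace G]

/-- The unfolding formula. -/
theorem integral_mul_periodize [LocallyCompactSpace G] (μ : Measure G)
    [IsFiniteMeasureOnCompacts μ]
    [μ.IsMulRightInvariant] {f₁ f₂ : G → ℝ} (h₁ : Continuous f₁) (hc₁ : HasCompactSupport f₁)
    (h₂ : Continuous f₂) (hc₂ : HasCompactSupport f₂) :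
    ∫ x, f₁ x * periodize Γ f₂ x ∂μ = ∫ x, periodize Γ f₁ x * f₂ x ∂μ := by
  -- If `f₁ x` and `f₂ (x * γ)` are both nonzero, then `γ ∈ (supp f₁)⁻¹ (supp f₂)`: a finite set
  -- independent of `x`, so sum and integral commute.
  have hfin := Γ.finite_setOf_mem_of_isCompact (hc₁.isCompact.inv.mul hc₂.isCompact)
  set S := hfin.toFinset
  have e₁ : ∀ x, f₁ x * periodize Γ f₂ x = ∑ γ ∈ S, f₁ x * f₂ (x * γ) := by
    intro x
    rw [periodize, mul_finsum]
    refine finsum_eq_sum_of_support_subset _ fun γ hγ => ?_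
    have h : f₁ x ≠ 0 ∧ f₂ (x * γ) ≠ 0 := by simpa using hγ
    simp only [S, Finite.coe_toFinset]
    exact ⟨x⁻¹, Set.inv_mem_inv.mpr (subset_tsupport _ h.1), x * γ, subset_tsupport _ h.2,
      inv_mul_cancel_left _ _⟩
  have e₂ : ∀ x, periodize Γ f₁ x * f₂ x = ∑ γ ∈ S, f₁ (x * (γ : G)⁻¹) * f₂ x := by
    intro x
    rw [periodize, finsum_mul, ← finsum_comp_equiv (Equiv.inv Γ)]
    refine finsum_eq_sum_of_support_subset _ fun γ hγ => ?_
    have h : f₁ (x * (γ : G)⁻¹) ≠ 0 ∧ f₂ x ≠ 0 := by simpa using hγ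
    simp only [S, Finite.coe_toFinset]
    exact ⟨(x * (γ : G)⁻¹)⁻¹, Set.inv_mem_inv.mpr (subset_tsupport _ h.1), x,
      subset_tsupport _ h.2, by simp⟩
  simp_rw [e₁, e₂]
  rw [integral_finsetSum, integral_finsetSum]
  · refine Finset.sum_congr rfl fun γ _ => ?_
    rw [← integral_mul_right_eq_self (fun x => f₁ (x * (γ : G)⁻¹) * f₂ x) (γ : G)]
    simp
  · intro γ _
    refine Continuous.integrable_of_hasCompactSupport (by fun_prop) ?_
    exact HasCompactSupport.mul_left hc₂
  · intro γ _
    refine Continuous.integrable_of_hasCompactSupport (by fun_prop) ?_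
    exact HasCompactSupport.mul_right hc₁

omit [MeasurableSpace G] [BorelSpace G] in
-- Divide a bump function equal to 1 on `K` by its periodization, which is positive because `K`
-- meets every coset.
theorem exists_periodize_eq_one [T2Space G] [LocallyCompactSpace G] {K K' : Set G}
    (hK : IsCompact K) (hKK' : K ⊆ interior K') (hKΓ : K * (Γ : Set G) = univ) :
    ∃ ψ : G → ℝ, Continuous ψ ∧ HasCompactSupport ψ ∧ (∀ x, 0 ≤ ψ x) ∧ (∀ x ∉ K', ψ x = 0) ∧
      ∀ g, periodize Γ ψ g = 1 := by
  obtain ⟨f, hf1, hf0, hfc, hfI⟩ := exists_continuous_one_zero_of_isCompact hK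
    isOpen_interior.isClosed_compl (disjoint_compl_right_iff_subset.mpr hKK')
  have hnn : ∀ x, 0 ≤ f x := fun x => (hfI x).1
  have hpos : ∀ g, 0 < periodize Γ f g := by
    intro g
    obtain ⟨k, hk, γ, hγ, rfl⟩ : g ∈ K * (Γ : Set G) := hKΓ ▸ mem_univ g
    refine periodize_pos Γ hfc hnn (inv_mem hγ) ?_
    simp [hf1 hk]
  refine ⟨fun x => f x * (periodize Γ f x)⁻¹, ?_, HasCompactSupport.mul_right hfc, ?_, ?_, ?_⟩
  · exact f.continuous.mul ((continuous_periodize Γ f.continuous hfc).inv₀ fun x => (hpos x).ne')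
  · exact fun x => mul_nonneg (hnn x) (inv_nonneg.mpr (hpos x).le)
  · intro x hx
    have : f x = 0 := hf0 fun h => hx (interior_subset h)
    simp [this]
  · intro g
    rw [periodize_mul_invariant Γ f _ fun x γ hγ => by rw [periodize_mul_right Γ f x hγ]]
    exact mul_inv_cancel₀ (hpos g).ne'

/-- A locally compact group with a uniform lattice is unimodular. -/
theorem isMulRightInvariant_of_isCompact_mul_eq_univ [T2Space G] [LocallyCompactSpace G]
    (μ : Measure G)
    [μ.IsHaarMeasure] [μ.Regular] {K : Set G} (hK : IsCompact K)
    (hKΓ : K * (Γ : Set G) = univ) : μ.IsMulRightInvariant := by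
  obtain ⟨K', hK', hKK'⟩ := exists_compact_superset hK
  obtain ⟨ψ, hψ, hψc, hψ0, -, hψ1⟩ := exists_periodize_eq_one Γ hK hKK' hKΓ
  have hψne : ∃ x, ψ x ≠ 0 := by
    by_contra! h
    have := hψ1 1
    simp [periodize, h] at this
  have hinv : ∀ f : G → ℝ, ∫ x, f x ∂μ.inv = ∫ x, f x⁻¹ ∂μ := fun f =>
    integral_map_equiv (MeasurableEquiv.inv G) f
  have : IsFiniteMeasureOnCompacts μ.inv := ⟨fun C hC => by
    rw [Measure.inv_apply]
    exact hC.inv.measure_lt_top⟩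
  refine ⟨fun g => ?_⟩
  have hreg : (Measure.map (· * g) μ).Regular := Measure.Regular.map (Homeomorph.mulRight g)
  have heq := Measure.isMulLeftInvariant_eq_smul_of_regular (Measure.map (· * g) μ) μ
  have hψic : HasCompactSupport fun x => ψ x⁻¹ := hψc.comp_homeomorph (Homeomorph.inv G)
  have hpos : 0 < ∫ x, ψ x⁻¹ ∂μ := by
    obtain ⟨x, hx⟩ := hψne
    refine Continuous.integral_pos_of_hasCompactSupport_nonneg_nonzero (x := x⁻¹)
      (by fun_prop) hψic (fun x => hψ0 _) (by simpa using hx)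
  -- Right translation scales `μ` by a constant, so one test function of nonzero integral decides
  -- it. Unfolding applies to `μ.inv`, which is right-invariant without any assumption of
  -- unimodularity.
  have e1 : ∫ x, ψ x⁻¹ ∂(Measure.map (· * g) μ) = ∫ x, ψ x⁻¹ ∂μ := by
    calc ∫ x, ψ x⁻¹ ∂(Measure.map (· * g) μ) = ∫ x, ψ (x * g)⁻¹ ∂μ :=
          integral_map_equiv (MeasurableEquiv.mulRight g) _
      _ = ∫ x, ψ (g⁻¹ * x) ∂μ.inv := by simp [hinv]
      _ = ∫ x, ψ (g⁻¹ * x) * periodize Γ ψ x ∂μ.inv := by simp [hψ1]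
      _ = ∫ x, periodize Γ (fun x => ψ (g⁻¹ * x)) x * ψ x ∂μ.inv :=
          integral_mul_periodize Γ μ.inv (by fun_prop)
            (hψc.comp_homeomorph (Homeomorph.mulLeft g⁻¹)) hψ hψc
      _ = ∫ x, ψ x ∂μ.inv := by simp [periodize_comp_mul_left, hψ1]
      _ = ∫ x, ψ x⁻¹ ∂μ := hinv _
  rw [heq, integral_smul_nnreal_measure, NNReal.smul_def, smul_eq_mul] at e1
  have hc : Measure.haarScalarFactor (Measure.map (· * g) μ) μ = 1 := by
    exact_mod_cast mul_right_cancel₀ hpos.ne' (e1.trans (one_mul _).symm)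
  rw [heq, hc, one_smul]

/-- `φ` is a continuous probability density on `G`, supported in `K`, that sums to a constant over
the left cosets of `Γ`. -/
structure IsCosetWeight (μ : Measure G) (Γ : Subgroup G) (K : Set G) (φ : G → ℝ) : Prop where
  continuous : Continuous φ
  hasCompactSupport : HasCompactSupport φ
  nonneg : ∀ x, 0 ≤ φ x
  eq_zero_of_notMem : ∀ x ∉ K, φ x = 0
  integral_eq_one : ∫ x, φ x ∂μ = 1
  exists_periodize_eq : ∃ c ≠ 0, ∀ g, periodize Γ φ g = c

/-- The support bound `K'` depends on `K` alone, so one compact set serves all lattices for which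
`K` meets every coset. -/
theorem exists_isCosetWeight [T2Space G] [LocallyCompactSpace G] (μ : Measure G)
    [μ.IsHaarMeasure] {K K' : Set G}
    (hK : IsCompact K) (hKK' : K ⊆ interior K') (hKΓ : K * (Γ : Set G) = univ) :
    ∃ φ, IsCosetWeight μ Γ K' φ := by
  obtain ⟨ψ, hψ, hψc, hψ0, hψK, hψ1⟩ := exists_periodize_eq_one Γ hK hKK' hKΓ
  have hψne : ∃ x, ψ x ≠ 0 := by
    by_contra! h
    have := hψ1 1
    simp [periodize, h] at this
  obtain ⟨x, hx⟩ := hψne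
  have hpos := hψ.integral_pos_of_hasCompactSupport_nonneg_nonzero hψc hψ0 hx (μ := μ)
  refine ⟨fun x => (∫ x, ψ x ∂μ)⁻¹ * ψ x, by fun_prop, HasCompactSupport.mul_left hψc,
    fun x => mul_nonneg (inv_nonneg.mpr hpos.le) (hψ0 x), fun x hx => by simp [hψK x hx], ?_,
    (∫ x, ψ x ∂μ)⁻¹, inv_ne_zero hpos.ne', fun g => ?_⟩
  · rw [integral_const_mul, inv_mul_cancel₀ hpos.ne']
  · rw [periodize_const_mul, hψ1, mul_one]

variable {Γ}

omit [IsTopologicalGroup G] [DiscreteTopology Γ] [IsClosed (Γ : Set G)] in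
theorem IsCosetWeight.integrable_mul {μ : Measure G} [IsFiniteMeasureOnCompacts μ] {K : Set G}
    {φ : G → ℝ} (hφ : IsCosetWeight μ Γ K φ) {u : G → ℝ} (hu : Continuous u) :
    Integrable (fun x => φ x * u x) μ :=
  (hφ.continuous.mul hu).integrable_of_hasCompactSupport hφ.hasCompactSupport.mul_right

/-- Move the translation onto `φ`, insert the constant `c = periodize Γ φ`, and unfold: the
translate of `φ` has the same coset sums as `φ`. -/
theorem IsCosetWeight.integral_mul_comp_mul_left [LocallyCompactSpace G] {μ : Measure G}
    [μ.IsHaarMeasure] [μ.IsMulRightInvariant] {K : Set G} {φ : G → ℝ}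
    (hφ : IsCosetWeight μ Γ K φ) {u : G → ℝ} (hu : Continuous u)
    (huΓ : ∀ g, ∀ γ ∈ Γ, u (g * γ) = u g) (h : G) :
    ∫ x, φ x * u (h * x) ∂μ = ∫ x, φ x * u x ∂μ := by
  obtain ⟨c, hc, hφc⟩ := hφ.exists_periodize_eq
  have hcont := hφ.continuous
  have hc' : HasCompactSupport fun x => φ (h⁻¹ * x) :=
    hφ.hasCompactSupport.comp_homeomorph (Homeomorph.mulLeft h⁻¹)
  refine mul_right_cancel₀ hc ?_
  calc (∫ x, φ x * u (h * x) ∂μ) * c = (∫ x, φ (h⁻¹ * x) * u x ∂μ) * c := by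
        rw [← integral_mul_left_eq_self (fun x => φ (h⁻¹ * x) * u x) h]
        simp
    _ = ∫ x, (φ (h⁻¹ * x) * u x) * periodize Γ φ x ∂μ := by simp [hφc, integral_mul_const]
    _ = ∫ x, periodize Γ (fun x => φ (h⁻¹ * x) * u x) x * φ x ∂μ :=
        integral_mul_periodize Γ μ (by fun_prop) hc'.mul_right hcont hφ.hasCompactSupport
    _ = ∫ x, (φ x * u x) * c ∂μ := by
        congr with x
        rw [periodize_mul_invariant Γ _ u huΓ, periodize_comp_mul_left, hφc]
        ring
    _ = (∫ x, φ x * u x ∂μ) * c := integral_mul_const _ _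

end Periodize

/-! ### Uniqueness of the invariant functional on the coset space. -/

section InvariantFunctional

open Filter Set CompactlySupported

variable {G : Type*} [Group G] [TopologicalSpace G] {Γ : Subgroup G}

/-- The function on `G ⧸ Γ` induced by a continuous right `Γ`-invariant function on `G`. -/
def cosetLift (u : G → ℝ) (hu : Continuous u) (huΓ : ∀ g, ∀ γ ∈ Γ, u (g * γ) = u g) :
    C(G ⧸ Γ, ℝ) where
  toFun := Quotient.lift u fun a b hab => by
    have h := huΓ a _ (QuotientGroup.leftRel_apply.mp hab)
    rw [← h, mul_inv_cancel_left]
  continuous_toFun := hu.quotient_lift _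

@[simp]
theorem cosetLift_mk (u : G → ℝ) (hu : Continuous u) (huΓ : ∀ g, ∀ γ ∈ Γ, u (g * γ) = u g)
    (g : G) : cosetLift u hu huΓ (g : G ⧸ Γ) = u g := rfl

theorem continuousMap_coset_ext {F₁ F₂ : C(G ⧸ Γ, ℝ)} (h : ∀ g : G, F₁ g = F₂ g) : F₁ = F₂ :=
  ContinuousMap.ext fun x => QuotientGroup.induction_on x h

variable [IsTopologicalGroup G]

/-- Left translation of functions on `G ⧸ Γ`. -/
def cosetTranslate (h : G) (F : C(G ⧸ Γ, ℝ)) : C(G ⧸ Γ, ℝ) :=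
  F.comp ⟨fun x => h • x, continuous_const_smul h⟩

@[simp]
theorem cosetTranslate_mk (h : G) (F : C(G ⧸ Γ, ℝ)) (g : G) :
    cosetTranslate h F (g : G ⧸ Γ) = F ((h * g : G) : G ⧸ Γ) := rfl

omit [IsTopologicalGroup G] in
theorem continuous_comp_coset_mk (F : C(G ⧸ Γ, ℝ)) : Continuous fun g : G => F (g : G ⧸ Γ) :=
  F.continuous.comp QuotientGroup.continuous_mk

omit [IsTopologicalGroup G] in
theorem coset_mk_mul_right (F : C(G ⧸ Γ, ℝ)) (g : G) {γ : G} (hγ : γ ∈ Γ) :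
    F ((g * γ : G) : G ⧸ Γ) = F (g : G ⧸ Γ) :=
  congrArg F (QuotientGroup.mk_mul_of_mem g hγ)

variable [DiscreteTopology Γ] [IsClosed (Γ : Set G)] [LocallyCompactSpace G]

/-- Periodization as a map to the functions on `G ⧸ Γ`. -/
noncomputable def cosetPeriodize (f : C_c(G, ℝ)) : C(G ⧸ Γ, ℝ) :=
  cosetLift (periodize Γ f) (continuous_periodize Γ f.continuous f.hasCompactSupport)
    fun g _ hγ => periodize_mul_right Γ f g hγ

/-- Pulling back a positive linear functional along periodization. -/
noncomputable def periodizeFunctional (L : C(G ⧸ Γ, ℝ) →ₗ[ℝ] ℝ)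
    (hL : ∀ F : C(G ⧸ Γ, ℝ), 0 ≤ F → 0 ≤ L F) : C_c(G, ℝ) →ₚ[ℝ] ℝ :=
  PositiveLinearMap.mk₀
    { toFun := fun f => L (cosetPeriodize f)
      map_add' := fun f₁ f₂ => by
        rw [← map_add]
        congr 1
        exact continuousMap_coset_ext fun g =>
          periodize_add Γ f₁.hasCompactSupport f₂.hasCompactSupport g
      map_smul' := fun c f => by
        rw [RingHom.id_apply, ← map_smul]
        congr 1
        exact continuousMap_coset_ext fun g => periodize_const_mul Γ c f g }
    fun f hf => hL _ fun x => QuotientGroup.induction_on x fun g =>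
      periodize_nonneg Γ (fun y => hf y) g

theorem periodizeFunctional_apply (L : C(G ⧸ Γ, ℝ) →ₗ[ℝ] ℝ)
    (hL : ∀ F : C(G ⧸ Γ, ℝ), 0 ≤ F → 0 ≤ L F) (f : C_c(G, ℝ)) :
    periodizeFunctional L hL f = L (cosetPeriodize f) := rfl

variable [T2Space G] [MeasurableSpace G] [BorelSpace G]

/-- Uniqueness of the normalized invariant positive functional on `G ⧸ Γ`. -/
theorem IsCosetWeight.eq_integral_of_invariant {μ : Measure G} [μ.IsHaarMeasure] {K : Set G}
    {φ : G → ℝ} (hφ : IsCosetWeight μ Γ K φ) (L : C(G ⧸ Γ, ℝ) →ₗ[ℝ] ℝ)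
    (hL : ∀ F : C(G ⧸ Γ, ℝ), 0 ≤ F → 0 ≤ L F) (hL1 : L 1 = 1)
    (hLinv : ∀ h F, L (cosetTranslate h F) = L F) (F : C(G ⧸ Γ, ℝ)) :
    L F = ∫ x, φ x * F (x : G ⧸ Γ) ∂μ := by
  -- Pulled back to `G`, the invariant functional becomes a left-invariant measure, to which
  -- uniqueness of Haar measure applies.
  set m := RealRMK.rieszMeasure (periodizeFunctional L hL) with hm
  have hmint : ∀ f : C_c(G, ℝ), ∫ x, f x ∂m = L (cosetPeriodize f) := fun f => by
    rw [hm, RealRMK.integral_rieszMeasure, periodizeFunctional_apply]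
  have hminv : m.IsMulLeftInvariant := by
    refine ⟨fun h => ?_⟩
    have : (m.map (h * ·)).Regular := Measure.Regular.map (Homeomorph.mulLeft h)
    refine Measure.ext_of_integral_eq_on_compactlySupported fun f => ?_
    let f' : C_c(G, ℝ) := ⟨⟨fun x => f (h * x), by fun_prop⟩,
      f.hasCompactSupport.comp_homeomorph (Homeomorph.mulLeft h)⟩
    calc ∫ x, f x ∂(m.map (h * ·)) = ∫ x, f' x ∂m :=
          integral_map_equiv (MeasurableEquiv.mulLeft h) _
      _ = L (cosetTranslate h (cosetPeriodize f)) := by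
          rw [hmint]
          congr 1
          exact continuousMap_coset_ext fun g => periodize_comp_mul_left Γ f h g
      _ = ∫ x, f x ∂m := by rw [hLinv, hmint]
  obtain ⟨c, hc, hφc⟩ := hφ.exists_periodize_eq
  have key : ∀ F : C(G ⧸ Γ, ℝ),
      c * L F = m.haarScalarFactor μ * ∫ x, φ x * F (x : G ⧸ Γ) ∂μ := by
    intro F
    let f : C_c(G, ℝ) := ⟨⟨fun x => φ x * F (x : G ⧸ Γ),
      hφ.continuous.mul (continuous_comp_coset_mk F)⟩, hφ.hasCompactSupport.mul_right⟩
    -- Every `F` is a periodization up to the factor `c`, so `L` is determined by `m`.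
    have h1 : cosetPeriodize f = c • F := continuousMap_coset_ext fun g => by
      refine (periodize_mul_invariant Γ φ (fun x => F (x : G ⧸ Γ))
        (fun g γ hγ => coset_mk_mul_right F g hγ) g).trans ?_
      rw [hφc]
      rfl
    have h2 := Measure.integral_isMulLeftInvariant_eq_smul_of_hasCompactSupport m μ f.continuous
      f.hasCompactSupport
    rw [integral_smul_nnreal_measure] at h2
    have h3 := (hmint f).symm.trans h2
    rw [h1, map_smul] at h3
    exact h3
  -- Normalization: `F = 1` shows that `c` equals the Haar scalar factor.
  have h1 := key 1
  rw [hL1] at h1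
  simp only [ContinuousMap.one_apply, mul_one, hφ.integral_eq_one] at h1
  have h2 := key F
  rw [h1] at h2
  exact mul_left_cancel₀ (h1 ▸ hc) h2

end InvariantFunctional

/-! ### Existence and uniqueness of the invariant probability measure. -/

section InvariantMeasure

open Filter Set CompactlySupported

variable {G : Type*} [Group G] [TopologicalSpace G]

theorem IsUniformLattice.exists_isCompact_mul_eq_univ [IsTopologicalGroup G] {Γ : Subgroup G}
    (hΓ : IsUniformLattice Γ) : ∃ K : Set G, IsCompact K ∧ K * (Γ : Set G) = univ := by
  obtain ⟨K, hK, h⟩ := hΓ.2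
  refine ⟨K⁻¹, hK.inv, ?_⟩
  have := congrArg (·⁻¹) h
  simpa [mul_inv_rev] using this

instance ULat.discreteTopology (Γ : ULat G) : DiscreteTopology Γ.1.toSubgroup := Γ.2.1

instance ULat.isClosed (Γ : ULat G) : IsClosed (Γ.1.toSubgroup : Set G) := Γ.1.isClosed'

variable [IsTopologicalGroup G]

instance ULat.compactSpace_cosets (Γ : ULat G) : CompactSpace Γ.Cosets := by
  obtain ⟨K, hK, h⟩ := Γ.2.exists_isCompact_mul_eq_univ
  refine ⟨?_⟩
  convert hK.image (QuotientGroup.continuous_mk (N := Γ.1.toSubgroup))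
  refine (eq_univ_of_forall fun x => ?_).symm
  obtain ⟨g, rfl⟩ := QuotientGroup.mk_surjective x
  obtain ⟨k, hk, γ, hγ, rfl⟩ : g ∈ K * (Γ.1.toSubgroup : Set G) := h ▸ mem_univ g
  exact ⟨k, hk, (QuotientGroup.mk_mul_of_mem k hγ).symm⟩

variable [T2Space G] [LocallyCompactSpace G] [MeasurableSpace G] [BorelSpace G]
  {Γ : ULat G} {μ : Measure G} [μ.IsHaarMeasure] {K : Set G} {φ : G → ℝ}

theorem ULat.IsInvariantProbability.integral_eq {ν : Γ.CosetMeasure}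
    (hν : Γ.IsInvariantProbability ν) (hφ : IsCosetWeight μ Γ.1.toSubgroup K φ)
    (F : C(Γ.Cosets, ℝ)) : ∫ x, F x ∂ν = ∫ x, φ x * F (x : Γ.Cosets) ∂μ := by
  let _ : MeasurableSpace Γ.Cosets := borel _
  have : BorelSpace Γ.Cosets := ⟨rfl⟩
  have := hν.isProbability
  have hint : ∀ F : C(Γ.Cosets, ℝ), Integrable F ν := fun F =>
    F.continuous.integrable_of_hasCompactSupport (HasCompactSupport.of_compactSpace F)
  refine hφ.eq_integral_of_invariant
    { toFun := fun F : C(Γ.Cosets, ℝ) => ∫ x, F x ∂ν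
      map_add' := fun F₁ F₂ => integral_add (hint F₁) (hint F₂)
      map_smul' := fun c F => integral_const_mul c F }
    (fun F hF => integral_nonneg hF) ?_ ?_ F
  · simp
  · intro h F
    change ∫ x, F (h • x) ∂ν = ∫ x, F x ∂ν
    conv_rhs => rw [← hν.invariant h]
    rw [integral_map (continuous_const_smul h).aemeasurable
      F.continuous.aestronglyMeasurable]

theorem ULat.IsInvariantProbability.unique {ν₁ ν₂ : Γ.CosetMeasure}
    (h₁ : Γ.IsInvariantProbability ν₁) (h₂ : Γ.IsInvariantProbability ν₂)
    (hφ : IsCosetWeight μ Γ.1.toSubgroup K φ) : ν₁ = ν₂ := by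
  let _ : MeasurableSpace Γ.Cosets := borel _
  have : BorelSpace Γ.Cosets := ⟨rfl⟩
  have := h₁.regular
  have := h₂.regular
  refine Measure.ext_of_integral_eq_on_compactlySupported fun f => ?_
  exact (h₁.integral_eq hφ f.toContinuousMap).trans (h₂.integral_eq hφ f.toContinuousMap).symm

omit [T2Space G] in
-- The measure represents the functional `F ↦ ∫ φ F dμ`, whose invariance is
-- `IsCosetWeight.integral_mul_comp_mul_left`.
theorem ULat.exists_isInvariantProbability [μ.IsMulRightInvariant]
    (hφ : IsCosetWeight μ Γ.1.toSubgroup K φ) :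
    ∃ ν : Γ.CosetMeasure, Γ.IsInvariantProbability ν := by
  let _ : MeasurableSpace Γ.Cosets := borel _
  have : BorelSpace Γ.Cosets := ⟨rfl⟩
  have hint : ∀ F : C_c(Γ.Cosets, ℝ), Integrable (fun x : G => φ x * F (x : Γ.Cosets)) μ :=
    fun F => hφ.integrable_mul (continuous_comp_coset_mk F.toContinuousMap)
  let L : C_c(Γ.Cosets, ℝ) →ₚ[ℝ] ℝ := PositiveLinearMap.mk₀
    { toFun := fun F => ∫ x, φ x * F (x : Γ.Cosets) ∂μ
      map_add' := fun F₁ F₂ => by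
        rw [← integral_add (hint F₁) (hint F₂)]
        simp [mul_add]
      map_smul' := fun c F => by
        rw [RingHom.id_apply, smul_eq_mul, ← integral_const_mul]
        simp [mul_left_comm] }
    fun F hF => integral_nonneg fun x => mul_nonneg (hφ.nonneg x) (hF _)
  have hν : ∀ F : C_c(Γ.Cosets, ℝ),
      ∫ x, F x ∂(RealRMK.rieszMeasure L) = ∫ x, φ x * F (x : Γ.Cosets) ∂μ :=
    fun F => RealRMK.integral_rieszMeasure L F
  refine ⟨RealRMK.rieszMeasure L, ?_, RealRMK.regular_rieszMeasure L, fun g => ?_⟩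
  · have h1 := hν ⟨1, HasCompactSupport.of_compactSpace _⟩
    refine ⟨?_⟩
    have h2 : (RealRMK.rieszMeasure L).real univ = 1 := by
      simpa [hφ.integral_eq_one] using h1
    exact (ENNReal.toReal_eq_one_iff _).mp h2
  · have : ((RealRMK.rieszMeasure L).map fun x : Γ.Cosets => g • x).Regular :=
      Measure.Regular.map (Homeomorph.smul g)
    refine Measure.ext_of_integral_eq_on_compactlySupported fun F => ?_
    let F' : C_c(Γ.Cosets, ℝ) := ⟨cosetTranslate g F.toContinuousMap,
      HasCompactSupport.of_compactSpace _⟩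
    calc ∫ x, F x ∂((RealRMK.rieszMeasure L).map fun x : Γ.Cosets => g • x)
        = ∫ x, F' x ∂(RealRMK.rieszMeasure L) :=
          integral_map (continuous_const_smul g).aemeasurable F.continuous.aestronglyMeasurable
      _ = ∫ x, F x ∂(RealRMK.rieszMeasure L) := by
          rw [hν, hν]
          exact hφ.integral_mul_comp_mul_left (u := fun x => F (x : Γ.Cosets))
            (continuous_comp_coset_mk F.toContinuousMap)
            (fun x γ hγ => coset_mk_mul_right F.toContinuousMap x hγ) g

end InvariantMeasure

/-! ### Convergence of the weighted integrals as the lattice varies. -/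

section Continuity

open Filter Set

variable {G : Type*} [Group G] [TopologicalSpace G] [IsTopologicalGroup G]

/-- The functions on `G ⧸ Γ` that extend to a continuous family of functions on all coset spaces
`G ⧸ H`, for `H` a closed subgroup. -/
def extendableSubalgebra (Γ : ULat G) : Subalgebra ℝ C(Γ.Cosets, ℝ) where
  carrier := {F | ∃ u : G × ClosedSubgroup G → ℝ, Continuous u ∧
    (∀ g H, ∀ h ∈ H, u (g * h, H) = u (g, H)) ∧ ∀ g : G, F g = u (g, Γ.1)}
  mul_mem' := by
    rintro F₁ F₂ ⟨u₁, hc₁, hi₁, he₁⟩ ⟨u₂, hc₂, hi₂, he₂⟩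
    exact ⟨fun p => u₁ p * u₂ p, hc₁.mul hc₂, fun g H h hh => by
      simp only [hi₁ g H h hh, hi₂ g H h hh],
      fun g => by simp [he₁, he₂]⟩
  add_mem' := by
    rintro F₁ F₂ ⟨u₁, hc₁, hi₁, he₁⟩ ⟨u₂, hc₂, hi₂, he₂⟩
    exact ⟨fun p => u₁ p + u₂ p, hc₁.add hc₂, fun g H h hh => by
      simp only [hi₁ g H h hh, hi₂ g H h hh],
      fun g => by simp [he₁, he₂]⟩
  algebraMap_mem' := fun r => ⟨fun _ => r, continuous_const, fun _ _ _ _ => rfl, fun _ => rfl⟩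

variable [T2Space G] [LocallyCompactSpace G]

omit [T2Space G] in
-- For a bump `f` equal to 1 at `a` and 0 on `bΓ`, `cosetSup f` is at least 1 on `aΓ` and at most 0
-- on `bΓ`, and it extends to all closed subgroups.
theorem extendableSubalgebra_separatesPoints (Γ : ULat G) :
    (extendableSubalgebra Γ).SeparatesPoints := by
  intro x y hxy
  obtain ⟨a, rfl⟩ := QuotientGroup.mk_surjective x
  obtain ⟨b, rfl⟩ := QuotientGroup.mk_surjective y
  have hcl : IsClosed {z : G | b⁻¹ * z ∈ Γ.1} :=
    Γ.1.isClosed_coe.preimage (continuous_const_mul b⁻¹)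
  have hab : Disjoint {a} {z : G | b⁻¹ * z ∈ Γ.1} := by
    rw [Set.disjoint_singleton_left]
    exact fun h => hxy (QuotientGroup.eq.mpr h).symm
  obtain ⟨f, hf1, hf0, hfc, hfI⟩ :=
    exists_continuous_one_zero_of_isCompact isCompact_singleton hcl hab
  have hnn : ∀ x, 0 ≤ f x := fun x => (hfI x).1
  have hu := continuous_cosetSup f.continuous hfc hnn
  have hi : ∀ g, ∀ γ ∈ Γ.1.toSubgroup, cosetSup f (g * γ) Γ.1 = cosetSup f g Γ.1 :=
    fun g γ hγ => cosetSup_mul_right f g Γ.1 hγ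
  refine ⟨_, ⟨cosetLift (fun g => cosetSup f g Γ.1) (hu.comp (Continuous.prodMk_left Γ.1)) hi,
    ⟨_, hu, fun g H h hh => cosetSup_mul_right f g H hh, fun g => rfl⟩, rfl⟩, ?_⟩
  simp only [cosetLift_mk]
  have ha : 1 ≤ cosetSup f a Γ.1 := by
    have h1 : f (a * (1 : Γ.1)) = 1 := by simpa using hf1 rfl
    rw [← h1]
    exact le_ciSup (HasCompactSupport.bddAbove_range_of_continuous f.continuous hfc
      fun h : Γ.1 => a * (h : G)) 1
  have hb : cosetSup f b Γ.1 ≤ 0 := ciSup_le fun h => (hf0 (by simp)).le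
  exact (hb.trans_lt (one_pos.trans_le ha)).ne'

omit [T2Space G] in
theorem extendableSubalgebra_dense (Γ : ULat G) :
    (extendableSubalgebra Γ).topologicalClosure = ⊤ :=
  ContinuousMap.subalgebra_topologicalClosure_eq_top_of_separatesPoints _
    (extendableSubalgebra_separatesPoints Γ)

omit [IsTopologicalGroup G] [T2Space G] [LocallyCompactSpace G] in
theorem eventually_forall_abs_sub_le {Γ : ULat G} {u : G × ClosedSubgroup G → ℝ}
    (hu : Continuous u) {K : Set G} (hK : IsCompact K) {ε : ℝ} (hε : 0 < ε) :
    ∀ᶠ Γ' : ULat G in 𝓝 Γ, ∀ x ∈ K, |u (x, Γ'.1) - u (x, Γ.1)| ≤ ε := by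
  refine hK.eventually_forall_of_forall_eventually fun x _ => ?_
  have hc : Continuous fun p : ULat G × G => |u (p.2, p.1.1) - u (p.2, Γ.1)| := by fun_prop
  have h0 : |u (x, Γ.1) - u (x, Γ.1)| < ε := by simpa using hε
  exact (hc.tendsto (Γ, x)).eventually_le_const h0

variable [MeasurableSpace G] [BorelSpace G] {μ : Measure G} [μ.IsHaarMeasure] {K : Set G}

omit [IsTopologicalGroup G] [T2Space G] [LocallyCompactSpace G] in
theorem IsCosetWeight.abs_integral_mul_le {Γ : Subgroup G} {φ : G → ℝ}
    (hφ : IsCosetWeight μ Γ K φ) {u : G → ℝ} {ε : ℝ} (hε : ∀ x ∈ K, |u x| ≤ ε) :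
    |∫ x, φ x * u x ∂μ| ≤ ε := by
  have hint : Integrable (fun x => φ x * ε) μ := hφ.integrable_mul continuous_const
  calc |∫ x, φ x * u x ∂μ| = ‖∫ x, φ x * u x ∂μ‖ := (Real.norm_eq_abs _).symm
    _ ≤ ∫ x, φ x * ε ∂μ := by
        refine norm_integral_le_of_norm_le hint (Eventually.of_forall fun x => ?_)
        by_cases hx : x ∈ K
        · rw [Real.norm_eq_abs, abs_mul, abs_of_nonneg (hφ.nonneg x)]
          exact mul_le_mul_of_nonneg_left (hε x hx) (hφ.nonneg x)
        · simp [hφ.eq_zero_of_notMem x hx]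
    _ = ε := by rw [integral_mul_const, hφ.integral_eq_one, one_mul]

omit [IsTopologicalGroup G] [T2Space G] [LocallyCompactSpace G] in
-- The weights have mass 1 on the common compact `K`, where `u (·, Γ')` is uniformly close to `u (·,
-- Γ)`; how the weights vary with `Γ'` is irrelevant.
theorem tendsto_integral_sub_of_isCosetWeight {Γ : ULat G} {l : Filter (ULat G)} (hl : l ≤ 𝓝 Γ)
    (hK : IsCompact K) {φ : ULat G → G → ℝ}
    (hφ : ∀ᶠ Γ' in l, IsCosetWeight μ Γ'.1.toSubgroup K (φ Γ')) {u : G × ClosedSubgroup G → ℝ}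
    (hu : Continuous u) :
    Tendsto (fun Γ' => ∫ x, φ Γ' x * u (x, Γ'.1) ∂μ - ∫ x, φ Γ' x * u (x, Γ.1) ∂μ) l (𝓝 0) := by
  refine Metric.tendsto_nhds.mpr fun ε hε => ?_
  filter_upwards [hφ, hl (eventually_forall_abs_sub_le hu hK (half_pos hε))] with Γ' h h'
  rw [← integral_sub (h.integrable_mul (u := fun x => u (x, Γ'.1)) (by fun_prop))
    (h.integrable_mul (u := fun x => u (x, Γ.1)) (by fun_prop)), Real.dist_0_eq_abs]
  simp_rw [← mul_sub]
  exact (h.abs_integral_mul_le h').trans_lt (half_lt_self hε)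

omit [T2Space G] [LocallyCompactSpace G] in
theorem exists_tendsto_integral_of_isCosetWeight {Γ : ULat G} {l : Ultrafilter (ULat G)}
    {φ : ULat G → G → ℝ}
    (hφ : ∀ᶠ Γ' in (l : Filter (ULat G)), IsCosetWeight μ Γ'.1.toSubgroup K (φ Γ'))
    (F : C(Γ.Cosets, ℝ)) :
    ∃ c ∈ Metric.closedBall (0 : ℝ) ‖F‖,
      Tendsto (fun Γ' => ∫ x, φ Γ' x * F (x : Γ.Cosets) ∂μ) l (𝓝 c) := by
  refine (isCompact_closedBall (0 : ℝ) ‖F‖).ultrafilter_le_nhds' (l.map _) ?_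
  change ∀ᶠ Γ' in (l : Filter (ULat G)), _ ∈ Metric.closedBall (0 : ℝ) ‖F‖
  filter_upwards [hφ] with Γ' h
  rw [mem_closedBall_zero_iff]
  exact h.abs_integral_mul_le fun x _ => F.norm_coe_le_norm _

/-- Any limit of the invariant probability measures of lattices converging to `Γ` is the invariant
probability measure of `Γ`. -/
theorem tendsto_ultrafilter_integral_of_isCosetWeight [μ.IsMulRightInvariant] {Γ : ULat G}
    {l : Ultrafilter (ULat G)} (hl : (l : Filter (ULat G)) ≤ 𝓝 Γ) (hK : IsCompact K)
    {φ : ULat G → G → ℝ}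
    (hφ : ∀ᶠ Γ' in (l : Filter (ULat G)), IsCosetWeight μ Γ'.1.toSubgroup K (φ Γ'))
    {K₀ : Set G} {φ₀ : G → ℝ} (hφ₀ : IsCosetWeight μ Γ.1.toSubgroup K₀ φ₀)
    (F : C(Γ.Cosets, ℝ)) :
    Tendsto (fun Γ' => ∫ x, φ Γ' x * F (x : Γ.Cosets) ∂μ) l
      (𝓝 (∫ x, φ₀ x * F (x : Γ.Cosets) ∂μ)) := by
  choose L hLn hL using exists_tendsto_integral_of_isCosetWeight (Γ := Γ) hφ
  have hFc : ∀ F : C(Γ.Cosets, ℝ), Continuous fun x : G => F (x : Γ.Cosets) :=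
    continuous_comp_coset_mk
  let Λ : C(Γ.Cosets, ℝ) →ₗ[ℝ] ℝ :=
    { toFun := L
      map_add' := fun F₁ F₂ => by
        refine tendsto_nhds_unique (hL _) (((hL F₁).add (hL F₂)).congr' ?_)
        filter_upwards [hφ] with Γ' h
        rw [← integral_add (h.integrable_mul (hFc F₁)) (h.integrable_mul (hFc F₂))]
        simp [mul_add]
      map_smul' := fun c F => by
        refine tendsto_nhds_unique (hL _) (((hL F).const_mul c).congr fun Γ' => ?_)
        rw [← integral_const_mul]
        simp [mul_left_comm] }
  have hLb : ∀ F, ‖L F‖ ≤ 1 * ‖F‖ := fun F => by simpa using hLn F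
  have hΛ : Continuous Λ := (Λ.mkContinuous 1 hLb).continuous
  -- The weight of `Γ'` is invariant only against functions constant on cosets of `Γ'`, which `F`
  -- need not be. An extendable `F` is replaced by `u (·, Γ')`, translated, and replaced back, with
  -- errors tending to 0.
  have hΛinv : ∀ h F, Λ (cosetTranslate h F) = Λ F := by
    intro h F
    have hclosed : IsClosed {F | Λ (cosetTranslate h F) = Λ F} :=
      isClosed_eq (hΛ.comp (ContinuousMap.continuous_precomp _)) hΛ
    have hsub : (extendableSubalgebra Γ : Set C(Γ.Cosets, ℝ)) ⊆
        {F | Λ (cosetTranslate h F) = Λ F} := by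
      rintro F ⟨u, hu, hui, hFu⟩
      have hu' : Continuous fun p : G × ClosedSubgroup G => u (h * p.1, p.2) := by fun_prop
      have t := (tendsto_integral_sub_of_isCosetWeight hl hK hφ hu).sub
        (tendsto_integral_sub_of_isCosetWeight hl hK hφ hu')
      refine tendsto_nhds_unique (hL _) ?_
      have t' := (hL F).add t
      simp only [sub_zero, add_zero] at t'
      refine t'.congr' ?_
      filter_upwards [hφ] with Γ' hw
      have := hw.integral_mul_comp_mul_left (u := fun x => u (x, Γ'.1)) (by fun_prop)
        (fun g γ hγ => hui g Γ'.1 γ hγ) h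
      simp only [cosetTranslate_mk, hFu, this]
      ring
    have hmem : F ∈ (extendableSubalgebra Γ).topologicalClosure := by
      rw [extendableSubalgebra_dense]
      trivial
    exact closure_minimal hsub hclosed hmem
  have key := hφ₀.eq_integral_of_invariant Λ ?_ ?_ hΛinv F
  · exact key ▸ hL F
  · intro F hF
    refine ge_of_tendsto (hL F) ?_
    filter_upwards [hφ] with Γ' h
    exact integral_nonneg fun x => mul_nonneg (h.nonneg x) (hF _)
  · refine tendsto_nhds_unique (hL 1) (tendsto_const_nhds.congr' ?_)
    filter_upwards [hφ] with Γ' h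
    simp [h.integral_eq_one]

theorem tendsto_integral_of_isCosetWeight [μ.IsMulRightInvariant] {Γ : ULat G}
    (hK : IsCompact K) {φ : ULat G → G → ℝ}
    (hφ : ∀ᶠ Γ' in 𝓝 Γ, IsCosetWeight μ Γ'.1.toSubgroup K (φ Γ'))
    {u : G × ClosedSubgroup G → ℝ} (hu : Continuous u)
    (hui : ∀ g H, ∀ h ∈ H, u (g * h, H) = u (g, H)) :
    Tendsto (fun Γ' => ∫ x, φ Γ' x * u (x, Γ'.1) ∂μ) (𝓝 Γ)
      (𝓝 (∫ x, φ Γ x * u (x, Γ.1) ∂μ)) := by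
  -- Along an ultrafilter bounded integrals converge, so no subsequences are needed.
  refine tendsto_iff_ultrafilter _ _ _ |>.mpr fun l hl => ?_
  have h1 := tendsto_integral_sub_of_isCosetWeight hl hK (hl hφ) hu
  have h2 := tendsto_ultrafilter_integral_of_isCosetWeight hl hK (hl hφ) hφ.self_of_nhds
    (cosetLift (fun g => u (g, Γ.1)) (by fun_prop) fun g γ hγ => hui g Γ.1 γ hγ)
  simpa using h1.add h2

end Continuity

/-! ### From invariant measures on coset spaces to invariant random subgroups. -/

section InvariantRandomSubgroups

open Filter Set

variable {G : Type*} [Group G] [TopologicalSpace G] [IsTopologicalGroup G]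

theorem conjClosed_conjClosed (g h : G) (H : ClosedSubgroup G) :
    conjClosed g (conjClosed h H) = conjClosed (g * h) H := by
  refine SetLike.ext fun x => ?_
  simp only [mem_conjClosed_iff, mul_inv_rev, mul_assoc]

theorem conjClosed_mul_right (g : G) {h : G} {H : ClosedSubgroup G} (hh : h ∈ H) :
    conjClosed (g * h) H = conjClosed g H := by
  rw [← conjClosed_conjClosed]
  congr 1
  refine SetLike.ext fun x => ?_
  rw [mem_conjClosed_iff]
  exact (Subgroup.mul_mem_cancel_right _ hh).trans (Subgroup.mul_mem_cancel_left _ (inv_mem hh))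

theorem ULat.conjClosed_cosetConj (Γ : ULat G) (g : G) (x : Γ.Cosets) :
    conjClosed g (Γ.cosetConj x) = Γ.cosetConj (g • x) := by
  obtain ⟨a, rfl⟩ := QuotientGroup.mk_surjective x
  exact conjClosed_conjClosed g a Γ.1

variable [LocallyCompactSpace G]

theorem ULat.exists_isCompact_eventually_mul_eq_univ
    (hG : IsCompactlyGeneratedGroup G) (Γ : ULat G) : ∃ K : Set G, IsCompact K ∧
      ∀ᶠ Γ' : ULat G in 𝓝 Γ, K * (Γ'.1.toSubgroup : Set G) = univ := by
  obtain ⟨-, K, hK, h⟩ := Γ.2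
  obtain ⟨K', hK', h'⟩ := eventually_mul_eq_univ hG hK h
  refine ⟨K'⁻¹, hK'.inv, ?_⟩
  filter_upwards [continuous_subtype_val.continuousAt.eventually h'] with Γ' hΓ'
  change (Γ'.1.toSubgroup : Set G) * K' = univ at hΓ'
  have := congrArg (·⁻¹) hΓ'
  simpa [mul_inv_rev] using this

theorem ULat.continuous_cosetConj (Γ : ULat G) : Continuous Γ.cosetConj :=
  (continuous_conjClosed.comp (Continuous.prodMk_left Γ.1)).quotient_lift _

theorem ULat.integral_pushforward (Γ : ULat G) (ν : Γ.CosetMeasure) {u : ClosedSubgroup G → ℝ}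
    (hu : Continuous u) : ∫ H, u H ∂(Γ.pushforward ν) = ∫ x, u (Γ.cosetConj x) ∂ν := by
  let _ : MeasurableSpace Γ.Cosets := borel _
  have : BorelSpace Γ.Cosets := ⟨rfl⟩
  have hm : Measurable Γ.cosetConj := Γ.continuous_cosetConj.measurable
  exact integral_map hm.aemeasurable hu.measurable.aestronglyMeasurable

/-- The pushforward of an invariant probability measure on `G ⧸ Γ` is an invariant random
subgroup. -/
theorem ULat.IsInvariantProbability.exists_irs [T2Space G] {Γ : ULat G} {ν : Γ.CosetMeasure}
    (hν : Γ.IsInvariantProbability ν) :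
    ∃ m : IRS G, (m.1 : Measure (ClosedSubgroup G)) = Γ.pushforward ν := by
  let _ : MeasurableSpace Γ.Cosets := borel _
  have : BorelSpace Γ.Cosets := ⟨rfl⟩
  have := hν.isProbability
  have := hν.regular
  have hm : Measurable Γ.cosetConj := Γ.continuous_cosetConj.measurable
  have hprob : IsProbabilityMeasure (Γ.pushforward ν) :=
    Measure.isProbabilityMeasure_map hm.aemeasurable
  -- Inner regularity by compact sets survives continuous maps; regularity then follows, the measure
  -- being finite.
  have hinner : (Γ.pushforward ν).InnerRegular :=
    Measure.InnerRegular.map_of_continuous Γ.continuous_cosetConj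
  refine ⟨⟨⟨Γ.pushforward ν, hprob⟩, ?_, fun g => ?_⟩, rfl⟩
  · change (Γ.pushforward ν).Regular
    infer_instance
  · have hg : Measurable (conjClosed g : ClosedSubgroup G → ClosedSubgroup G) :=
      (continuous_conjClosed.comp (Continuous.prodMk_right g)).measurable
    change Measure.map _ (Measure.map _ ν) = Measure.map _ ν
    conv_rhs => rw [← hν.invariant g]
    rw [Measure.map_map hg hm, Measure.map_map hm (continuous_const_smul g).measurable]
    congr 1
    exact funext fun x => Γ.conjClosed_cosetConj g x

end InvariantRandomSubgroups

/-! ### The main theorem. -/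

theorem proposition9 (G : Type*) [Group G] [TopologicalSpace G] [IsTopologicalGroup G]
    [T2Space G] [LocallyCompactSpace G] (hG : IsCompactlyGeneratedGroup G) :
    (∀ Γ : ULat G, ∃! ν : Γ.CosetMeasure, Γ.IsInvariantProbability ν) ∧
    ∃ I : ULat G → IRS G,
      (∀ (Γ : ULat G) (ν : Γ.CosetMeasure), Γ.IsInvariantProbability ν →
        ((I Γ).1 : MeasureTheory.Measure (ClosedSubgroup G)) = Γ.pushforward ν) ∧
      Continuous I := by
  let _ : MeasurableSpace G := borel G
  have : BorelSpace G := ⟨rfl⟩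
  let μ : Measure G := Measure.haar
  -- Unimodularity is known only once `G` has a uniform lattice.
  have hμ : ∀ _ : ULat G, μ.IsMulRightInvariant := fun Γ => by
    obtain ⟨K, hK, h⟩ := Γ.2.exists_isCompact_mul_eq_univ
    exact isMulRightInvariant_of_isCompact_mul_eq_univ Γ.1.toSubgroup μ hK h
  have hex : ∀ Γ : ULat G, ∃! ν : Γ.CosetMeasure, Γ.IsInvariantProbability ν := by
    intro Γ
    have := hμ Γ
    obtain ⟨K, hK, h⟩ := Γ.2.exists_isCompact_mul_eq_univ
    obtain ⟨K', -, hKK'⟩ := exists_compact_superset hK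
    obtain ⟨φ, hφ⟩ := exists_isCosetWeight Γ.1.toSubgroup μ hK hKK' h
    obtain ⟨ν, hν⟩ := ULat.exists_isInvariantProbability hφ
    exact ⟨ν, hν, fun ν' hν' => hν'.unique hν hφ⟩
  refine ⟨hex, ?_⟩
  choose ν hν hνu using hex
  choose I hI using fun Γ => (hν Γ).exists_irs
  refine ⟨I, fun Γ ν' hν' => by rw [hI, hνu Γ ν' hν'], ?_⟩
  refine continuous_iff_continuousAt.mpr fun Γ => ?_
  refine tendsto_subtype_rng.mpr
    (ProbabilityMeasure.tendsto_iff_forall_integral_tendsto.mpr fun Ψ => ?_)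
  have := hμ Γ
  obtain ⟨K, hK, hKΓ⟩ := Γ.exists_isCompact_eventually_mul_eq_univ hG
  obtain ⟨K', hK', hKK'⟩ := exists_compact_superset hK
  -- Lattices for which `K` fails to meet every coset get the dummy weight 0; none of them is near
  -- `Γ`.
  have hw : ∀ Γ' : ULat G, ∃ φ : G → ℝ, K * (Γ'.1.toSubgroup : Set G) = Set.univ →
      IsCosetWeight μ Γ'.1.toSubgroup K' φ := by
    intro Γ'
    by_cases h : K * (Γ'.1.toSubgroup : Set G) = Set.univ
    · obtain ⟨φ, hφ⟩ := exists_isCosetWeight Γ'.1.toSubgroup μ hK hKK' h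
      exact ⟨φ, fun _ => hφ⟩
    · exact ⟨0, fun h' => absurd h' h⟩
  choose φ hφ using hw
  have hφ' : ∀ᶠ Γ' in 𝓝 Γ, IsCosetWeight μ Γ'.1.toSubgroup K' (φ Γ') :=
    hKΓ.mono fun Γ' h => hφ Γ' h
  have hint : ∀ Γ' : ULat G, IsCosetWeight μ Γ'.1.toSubgroup K' (φ Γ') →
      ∫ H, Ψ H ∂((I Γ').1 : Measure (ClosedSubgroup G)) =
        ∫ x, φ Γ' x * Ψ (conjClosed x Γ'.1) ∂μ := by
    intro Γ' h
    rw [hI, Γ'.integral_pushforward _ Ψ.continuous]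
    exact (hν Γ').integral_eq h
      ⟨fun x => Ψ (Γ'.cosetConj x), Ψ.continuous.comp Γ'.continuous_cosetConj⟩
  rw [hint Γ hφ'.self_of_nhds]
  refine (tendsto_integral_of_isCosetWeight hK' hφ'
    (u := fun p => Ψ (conjClosed p.1 p.2)) (Ψ.continuous.comp continuous_conjClosed)
    fun g H h hh => by rw [conjClosed_mul_right g hh]).congr' ?_
  filter_upwards [hφ'] with Γ' h using (hint Γ' h).symm
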